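/- An inversion sequence of length $n$ is an integer sequence $\sigma=(\sigma_1,\dots,\sigma_n)$ with $0\le\sigma_i\le i-1$ for all $i$; let $\mathcal I_n$ be the set of these. Let $\mathcal P_n$ be the set of Cayley permutations of length $n$, i.e. of integer sequences whose set of values is exactly $\{0,1,\dots,\max\}$. For $n\ge1$, $k\ge0$ let $\mathcal{IP}_{n,k}$ be the set of all $\sigma\in\mathcal I_n\cap\mathcal P_n$ with $\max(\sigma)=k$. For $n,k\ge1$ let $\mathcal T_{n,k}$ be the set of non-plane rooted labelled trees that are increasing (every non-root node has a greater label than its parent) and have $n$ internal nodes, labelled by $0,\dots,n-1$, and $k$ leaves, labelled by $n,\dots,n+k-1$. Let $$T(x,y)=\sum_{n,k\ge1}\frac{|\mathcal T_{n,k}|}{n!\,k!}x^ny^k .$$ For $\sigma\in\mathcal I_n$ let $\varphi(\sigma)$ be the graph on the nodes $0,\dots,n$, rooted at $0$, in which each node $v$ is joined to the positions $i\in\{1,\dots,n\}$ with $\sigma_i=v$. For $s\in\mathbb Z$, let the poly-Bernoulli numbers of type C $C_j^{(s)}$ be defined by $$\sum_{j\ge0}C_j^{(s)}\frac{t^j}{j!}=\frac{\mathrm{Li}_s(1-e^{-t})}{e^t-1},\qquad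 \mathrm{Li}_s(z)=\sum_{m\ge1}\frac{z^m}{m^s}.$$ **Theorem.** 1. As formal power series, $$T(x,y)=\log\left(\frac{1}{e^x+e^y-e^{x+y}}\right).$$ 2. For every $n\ge0$ and $\sigma\in\mathcal I_n$, $\varphi(\sigma)$ is an increasing tree in which the children of each node $v$ are exactly the positions of the value $v$ in $\sigma$. For $n\ge1$ and $k\ge0$, $\mathcal{IP}_{n,k}$ is the set of inversion sequences of length $n$ whose set of values is exactly $\{0,\dots,k\}$, and for $0\le k<n$, $\varphi$ restricts to a bijection from $\mathcal{IP}_{n,k}$ onto $\mathcal T_{k+1,n-k}$. 3. For all $n,k\ge1$, $|\mathcal T_{n,k}|=C_{k-1}^{(-n)}$, and for all $n\ge1$, $$|\mathcal I_n\cap\mathcal P_n|=\sum_{k=0}^{n-1}|\mathcal T_{k+1,n-k}|=\sum_{k=0}^{n-1}C_{n-k-1}^{(-(k+1))}.$$ -/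

import Mathlib

open scoped Nat

namespace IncreasingTrees

/-- The inversion sequences of length `n`: `σ_i ∈ {0, …, i - 1}` for `i ∈ {1, …, n}`. The entry
`σ_i` at the (1-based) position `i` is `σ (i - 1)`, so that the bound reads `σ i ≤ i`. -/
def inversionSequences (n : ℕ) : Set (Fin n → ℕ) :=
  {σ | ∀ i : Fin n, σ i ≤ (i : ℕ)}

/-- The Cayley permutations of length `n`: the sequences whose set of values is exactly
`{0, …, max}` (the empty sequence is one). -/
def cayleyPermutations (n : ℕ) : Set (Fin n → ℕ) :=
  {ρ | Set.range ρ = {j | ∃ i, j ≤ ρ i}}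

/-- The inversion sequences of length `n` that are Cayley permutations and have maximum `k`. -/
def inversionCayley (n k : ℕ) : Set (Fin n → ℕ) :=
  {σ | σ ∈ inversionSequences n ∩ cayleyPermutations n ∧ IsGreatest (Set.range σ) k}

/-- A graph on the nodes `0, …, size - 1` (each node is identified with its label) with a
distinguished root. There is no order on the neighbours of a node, so those that are trees are
the non-plane labelled rooted trees. -/
structure LabelledRootedGraph where
  size : ℕ
  graph : SimpleGraph (Fin size)
  root : Fin size

namespace LabelledRootedGraph

variable (t : LabelledRootedGraph)

/-- In a rooted tree, `u` is the parent of `v` (and `v` is a child of `u`) if they are adjacent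
and `v` is one step further away from the root than `u`. -/
def IsParent (u v : Fin t.size) : Prop :=
  t.graph.Adj u v ∧ t.graph.dist t.root v = t.graph.dist t.root u + 1

/-- Every node other than the root has a greater label than its parent. -/
def IsIncreasing : Prop :=
  ∀ u v : Fin t.size, t.IsParent u v → u < v

/-- A node is internal if it has a child; otherwise it is a leaf. -/
def IsInternal (u : Fin t.size) : Prop :=
  ∃ v : Fin t.size, t.IsParent u v

end LabelledRootedGraph

/-- The non-plane increasing trees with `n` internal nodes, labelled by `0, …, n - 1`, and
`k` leaves, labelled by `n, …, n + k - 1`. -/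
def increasingTrees (n k : ℕ) : Set LabelledRootedGraph :=
  {t | t.graph.IsTree ∧ t.IsIncreasing ∧ t.size = n + k ∧
    ∀ v : Fin t.size, t.IsInternal v ↔ (v : ℕ) < n}

/-- The graph on the nodes `0, …, n` in which each node `v` is joined to the positions
`i ∈ {1, …, n}` of the value `v` in `σ`. -/
def phiGraph (n : ℕ) (σ : Fin n → ℕ) : SimpleGraph (Fin (n + 1)) :=
  SimpleGraph.fromRel fun v w => ∃ i : Fin n, w = i.succ ∧ σ i = (v : ℕ)

/-- The map from inversion sequences of length `n` to trees on the nodes `0, …, n`: the root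
is `0`, and the children of the node `v` are the positions of the value `v` in `σ`. -/
abbrev phi (n : ℕ) (σ : Fin n → ℕ) : LabelledRootedGraph where
  size := n + 1
  graph := phiGraph n σ
  root := 0

/-- The doubly exponential generating function
`∑_{n, k ≥ 1} |T_{n,k}| x ^ n y ^ k / (n! k!)` of increasing trees, as a formal power series in
`x = X 0` and `y = X 1`. -/
noncomputable def treeEGF : MvPowerSeries (Fin 2) ℚ := fun d =>
  if 1 ≤ d 0 ∧ 1 ≤ d 1 then
    ((increasingTrees (d 0) (d 1)).ncard : ℚ) / ((d 0)! * (d 1)!)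
  else 0

/-- `exp f` for a formal power series `f` with zero constant term. -/
noncomputable def formalExp (f : MvPowerSeries (Fin 2) ℚ) : MvPowerSeries (Fin 2) ℚ :=
  (PowerSeries.exp ℚ).subst f

/-- `log f` for a formal power series `f` with constant term `1`; here `PowerSeries.log ℚ` is
the series `log (1 + X)`. -/
noncomputable def formalLog (f : MvPowerSeries (Fin 2) ℚ) : MvPowerSeries (Fin 2) ℚ :=
  (PowerSeries.log ℚ).subst (f - 1)

/-- The formal power series `e ^ x + e ^ y - e ^ (x + y)`. -/
noncomputable def expDenominator : MvPowerSeries (Fin 2) ℚ :=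
  formalExp (MvPowerSeries.X 0) + formalExp (MvPowerSeries.X 1)
    - formalExp (MvPowerSeries.X 0 + MvPowerSeries.X 1)

theorem constantCoeff_formalExp (f : MvPowerSeries (Fin 2) ℚ)
    (hf : MvPowerSeries.constantCoeff f = 0) :
    MvPowerSeries.constantCoeff (formalExp f) = 1 := by
  have h := PowerSeries.HasSubst.of_constantCoeff_zero hf
  have e : PowerSeries.exp ℚ = (PowerSeries.exp ℚ - 1) + 1 := by ring
  rw [formalExp, e, PowerSeries.subst_add h, map_add,
    PowerSeries.constantCoeff_subst_eq_zero hf _ (by simp)]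
  have h1 : PowerSeries.subst f (1 : PowerSeries ℚ) = 1 := by
    rw [← PowerSeries.coe_substAlgHom h, map_one]
  simp [h1]

/-- The constant term of `e ^ x + e ^ y - e ^ (x + y)` is `1`, so that its inverse, and the
logarithm of its inverse, are genuine. -/
theorem constantCoeff_expDenominator :
    MvPowerSeries.constantCoeff expDenominator = 1 := by
  rw [expDenominator, map_sub, map_add, constantCoeff_formalExp _ (by simp),
    constantCoeff_formalExp _ (by simp), constantCoeff_formalExp _ (by simp)]
  norm_num

/-- The formal polylogarithm `Li_s(z) = ∑_{m ≥ 1} z ^ m / m ^ s`, for an integer `s`. -/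
noncomputable def polylog (s : ℤ) : PowerSeries ℚ :=
  PowerSeries.mk fun m => if m = 0 then 0 else ((m : ℚ) ^ s)⁻¹

/-- The series `1 - e ^ (-t)`. -/
noncomputable def oneSubExpNeg : PowerSeries ℚ :=
  1 - PowerSeries.evalNegHom (PowerSeries.exp ℚ)

/-- The poly-Bernoulli number of type C (of Arakawa and Kaneko) `C_j^{(s)}`, given by
`∑_{j ≥ 0} C_j^{(s)} t ^ j / j! = Li_s(1 - e ^ (-t)) / (e ^ t - 1)`; the quotient is taken in
the field of formal Laurent series. -/
noncomputable def polyBernoulliC (s : ℤ) (j : ℕ) : ℚ :=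
  (j ! : ℚ) * HahnSeries.coeff
    ((((polylog s).subst oneSubExpNeg : PowerSeries ℚ) : LaurentSeries ℚ)
      / ((PowerSeries.exp ℚ - 1 : PowerSeries ℚ) : LaurentSeries ℚ)) (j : ℤ)

end IncreasingTrees

namespace IncreasingTrees

/-! An increasing tree on `0, …, n` is determined by its parent function, which is an inversion
sequence; its internal nodes are the values taken. So trees with `n + 1` internal nodes and `k ≥ 1`
leaves correspond to inversion sequences of length `n + k` with value set `{0, …, n}` (`phi_bijOn`).

In such a sequence the last `k` entries are all bounded by `n`, so inclusion-exclusion over a set of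
missed values gives a signed sum of `k`-th powers. Hence the exponential generating function in `k`
is a combination `L_n` (`leafEGF n`) of powers of `e^t`, and `L_0 = e^t - 1`, `L_{n+1} = (e^t - 1)
L_n'` (`leafEGF_succ`).

This recurrence gives both counting results. It is also satisfied by `Li_{-n}(1 - e^{-t})`
(`eq_polylog_subst`), so dividing `L_{n+1}` by `e^t - 1` leaves `L_n'`, whose coefficients are the
type C numbers. Summed over rows it is the equation `T_x = (e^y - 1)(1 + T_y)`, also solved by the
logarithm; both series vanish at `x = 0`, which makes the solution unique
(`eq_of_satisfiesTreePDE`). -/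

/-! ### Inversion sequences as increasing trees -/

theorem exists_adj_dist_add_one {V : Type*} {G : SimpleGraph V} (hG : G.Connected) {r v : V}
    (h : v ≠ r) : ∃ u, G.Adj u v ∧ G.dist r v = G.dist r u + 1 := by
  obtain ⟨p, hp⟩ := (hG v r).exists_walk_length_eq_dist
  cases p with
  | nil => exact absurd rfl h
  | @cons _ u _ huv q =>
    refine ⟨u, huv.symm, ?_⟩
    rw [SimpleGraph.Walk.length_cons] at hp
    rw [SimpleGraph.dist_comm, SimpleGraph.dist_comm (u := r) (v := u)]
    have h1 := SimpleGraph.dist_le q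
    have h2 := hG.dist_triangle (u := v) (v := u) (w := r)
    rw [SimpleGraph.dist_eq_one_iff_adj.2 huv] at h2
    omega

theorem phiGraph_adj {n : ℕ} {σ : Fin n → ℕ} (hσ : σ ∈ inversionSequences n)
    {v w : Fin (n + 1)} : (phiGraph n σ).Adj v w ↔
      (∃ i : Fin n, w = i.succ ∧ σ i = (v : ℕ)) ∨ ∃ i : Fin n, v = i.succ ∧ σ i = (w : ℕ) := by
  rw [phiGraph, SimpleGraph.fromRel_adj]
  refine ⟨fun h => h.2, fun h => ⟨?_, h⟩⟩
  rintro rfl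
  rcases h with ⟨i, rfl, hi⟩ | ⟨i, rfl, hi⟩ <;>
  · have := hσ i
    simp at hi
    omega

theorem phiGraph_connected {n : ℕ} {σ : Fin n → ℕ} (hσ : σ ∈ inversionSequences n) :
    (phiGraph n σ).Connected := by
  have key : ∀ m : ℕ, ∀ v : Fin (n + 1), (v : ℕ) = m → (phiGraph n σ).Reachable 0 v := by
    intro m
    induction m using Nat.strong_induction_on with
    | _ m ih =>
      intro v hv
      induction v using Fin.cases with
      | zero => exact SimpleGraph.Reachable.refl _
      | succ i =>
        have h := hσ i
        have hi : (i.succ : Fin (n + 1)).val = i + 1 := Fin.val_succ i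
        refine (ih (σ i) (by omega) ⟨σ i, by omega⟩ rfl).trans
          (SimpleGraph.Adj.reachable ((phiGraph_adj hσ).2 (Or.inl ⟨i, rfl, rfl⟩)))
  exact (SimpleGraph.connected_iff_exists_forall_reachable _).2 ⟨0, fun v => key v v rfl⟩

/-- The graph is connected and has one edge per position, recovered from the edge as its larger
endpoint: `n` edges on `n + 1` nodes. -/
theorem phiGraph_isTree {n : ℕ} {σ : Fin n → ℕ} (hσ : σ ∈ inversionSequences n) :
    (phiGraph n σ).IsTree := by
  rw [SimpleGraph.isTree_iff_connected_and_card]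
  refine ⟨phiGraph_connected hσ, ?_⟩
  have hlt : ∀ i : Fin n, σ i < n + 1 := fun i => by have := hσ i; omega
  let e : Fin n → (phiGraph n σ).edgeSet := fun i =>
    ⟨s(⟨σ i, hlt i⟩, i.succ), (phiGraph_adj hσ).2 (Or.inl ⟨i, rfl, rfl⟩)⟩
  have he : Function.Bijective e := by
    constructor
    · intro i j hij
      have h := congrArg Subtype.val hij
      simp only [e, Sym2.eq_iff] at h
      rcases h with h | h
      · exact Fin.succ_injective _ h.2
      · have h1 := congrArg Fin.val h.1
        have h2 := congrArg Fin.val h.2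
        have := hσ i
        have := hσ j
        simp at h1 h2
        omega
    · rintro ⟨s, hs⟩
      induction s using Sym2.ind with
      | _ v w =>
        rcases (phiGraph_adj hσ).1 hs with ⟨i, rfl, hi⟩ | ⟨i, rfl, hi⟩
        · exact ⟨i, Subtype.ext (by simp [e, hi])⟩
        · exact ⟨i, Subtype.ext (by simp [e, hi])⟩
  rw [← Nat.card_congr (Equiv.ofBijective e he)]
  simp

theorem phiGraph_dist_succ {n : ℕ} {σ : Fin n → ℕ} (hσ : σ ∈ inversionSequences n)
    {i : Fin n} {v : Fin (n + 1)} (hv : σ i = (v : ℕ)) :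
    (phiGraph n σ).dist 0 i.succ = (phiGraph n σ).dist 0 v + 1 := by
  have hT := phiGraph_isTree hσ
  -- No edge has its larger end nearer the root. Otherwise the next node on the way from that end to
  -- the root would be a child of it, giving an edge of the same kind at smaller distance; the
  -- descent would end with a successor equal to the root `0`.
  have key : ∀ m : ℕ, ∀ (i : Fin n) (v : Fin (n + 1)), σ i = (v : ℕ) →
      (phiGraph n σ).dist 0 i.succ = m → (phiGraph n σ).dist 0 v ≠ m + 1 := by
    intro m
    induction m with
    | zero =>
      intro i v _ h0 _
      exact (Fin.succ_ne_zero i).symm ((phiGraph_connected hσ 0 i.succ).dist_eq_zero_iff.1 h0)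
    | succ m ih =>
      intro i v hv hm hd
      obtain ⟨u, hu, hdu⟩ := exists_adj_dist_add_one hT.1 (Fin.succ_ne_zero i)
      rcases (phiGraph_adj hσ).1 hu with ⟨j, hj, hju⟩ | ⟨j, rfl, hj⟩
      · obtain rfl := Fin.succ_injective _ hj
        have : u = v := Fin.ext (by omega)
        subst this
        omega
      · exact ih j i.succ hj (by omega) (by omega)
  rcases hT.dist_eq_dist_add_one_of_adj 0
    ((phiGraph_adj hσ).2 (Or.inl ⟨i, rfl, hv⟩)) with h | h
  · exact absurd h (key _ i v hv rfl)
  · exact h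

theorem phi_isParent {n : ℕ} {σ : Fin n → ℕ} (hσ : σ ∈ inversionSequences n)
    (v w : Fin (n + 1)) :
    (phi n σ).IsParent v w ↔ ∃ i : Fin n, w = i.succ ∧ σ i = (v : ℕ) := by
  constructor
  · rintro ⟨hadj, hd⟩
    rcases (phiGraph_adj hσ).1 hadj with h | ⟨i, rfl, hi⟩
    · exact h
    · have := phiGraph_dist_succ hσ hi
      change (phiGraph n σ).dist 0 w = (phiGraph n σ).dist 0 i.succ + 1 at hd
      omega
  · rintro ⟨i, rfl, hi⟩
    exact ⟨(phiGraph_adj hσ).2 (Or.inl ⟨i, rfl, hi⟩), phiGraph_dist_succ hσ hi⟩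

theorem phi_isIncreasing {n : ℕ} {σ : Fin n → ℕ} (hσ : σ ∈ inversionSequences n) :
    (phi n σ).IsIncreasing := by
  intro u v h
  obtain ⟨i, rfl, hi⟩ := (phi_isParent hσ u v).1 h
  have := hσ i
  rw [Fin.lt_def, Fin.val_succ]
  omega

theorem phi_isInternal {n : ℕ} {σ : Fin n → ℕ} (hσ : σ ∈ inversionSequences n)
    (v : Fin (n + 1)) : (phi n σ).IsInternal v ↔ (v : ℕ) ∈ Set.range σ := by
  constructor
  · rintro ⟨w, hw⟩
    obtain ⟨i, -, hi⟩ := (phi_isParent hσ v w).1 hw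
    exact ⟨i, hi⟩
  · rintro ⟨i, hi⟩
    exact ⟨i.succ, (phi_isParent hσ v _).2 ⟨i, rfl, hi⟩⟩

theorem phi_injOn (n : ℕ) : Set.InjOn (phi n) (inversionSequences n) := by
  intro σ hσ τ hτ h
  have hg : phiGraph n σ = phiGraph n τ := by
    simpa [phi] using h
  funext i
  have hi := hσ i
  have hadj : (phiGraph n τ).Adj ⟨σ i, by omega⟩ i.succ :=
    hg ▸ (phiGraph_adj hσ).2 (Or.inl ⟨i, rfl, rfl⟩)
  rcases (phiGraph_adj hτ).1 hadj with ⟨j, hj, hjv⟩ | ⟨j, hj, hjv⟩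
  · obtain rfl := Fin.succ_injective _ hj
    exact hjv.symm
  · have h1 := congrArg Fin.val hj
    have := hτ j
    simp at h1 hjv
    omega

/-- Every increasing tree on `n + 1` nodes comes from an inversion sequence. -/
theorem exists_phi_eq {n : ℕ} {t : LabelledRootedGraph} (hT : t.graph.IsTree)
    (hI : t.IsIncreasing) (hs : t.size = n + 1) : ∃ σ ∈ inversionSequences n, phi n σ = t := by
  obtain ⟨size, G, r⟩ := t
  obtain rfl : size = n + 1 := hs
  have hpar : ∀ v : Fin (n + 1), v ≠ r → ∃ u : Fin (n + 1), u < v ∧ G.Adj u v := by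
    intro v hv
    obtain ⟨u, hu, hd⟩ := exists_adj_dist_add_one hT.1 hv
    exact ⟨u, hI u v ⟨hu, hd⟩, hu⟩
  have hr : r = 0 := by
    by_contra h
    obtain ⟨u, hu, -⟩ := hpar 0 (Ne.symm h)
    exact absurd hu (Fin.not_lt_zero u)
  subst hr
  choose f hf hadj using fun i : Fin n => hpar i.succ (Fin.succ_ne_zero i)
  have hσ : (fun i => (f i : ℕ)) ∈ inversionSequences n := by
    intro i
    have := Fin.lt_def.1 (hf i)
    rw [Fin.val_succ] at this
    exact Nat.lt_succ_iff.1 this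
  refine ⟨fun i => f i, hσ, ?_⟩
  have hle : phiGraph n (fun i => (f i : ℕ)) ≤ G := by
    intro v w hvw
    rcases (phiGraph_adj hσ).1 hvw with ⟨i, rfl, hi⟩ | ⟨i, rfl, hi⟩
    · rw [← Fin.ext hi]; exact hadj i
    · rw [← Fin.ext hi]; exact (hadj i).symm
  -- The chosen parent edges already form a connected spanning subgraph, and a tree is minimal among
  -- connected graphs.
  have hge := (SimpleGraph.isTree_iff_minimal_connected.1 hT).2 (phiGraph_connected hσ) hle
  rw [phi, le_antisymm hle hge]

/-! ### Cayley inversion sequences and the bijection -/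

theorem inversionCayley_eq {n : ℕ} (k : ℕ) : inversionCayley n k =
    {σ | σ ∈ inversionSequences n ∧ Set.range σ = Set.Iic k} := by
  ext σ
  constructor
  · rintro ⟨⟨hσ, hc⟩, ⟨i, hi⟩, hk⟩
    refine ⟨hσ, ?_⟩
    ext j
    refine ⟨fun hj => hk hj, fun hj => ?_⟩
    have hc' : Set.range σ = {j | ∃ i, j ≤ σ i} := hc
    rw [hc']
    exact ⟨i, hi ▸ hj⟩
  · rintro ⟨hσ, hr⟩
    refine ⟨⟨hσ, ?_⟩, ?_⟩
    · change Set.range σ = {j | ∃ i, j ≤ σ i}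
      ext j
      refine ⟨fun ⟨i, hi⟩ => ⟨i, hi.ge⟩, fun ⟨i, hi⟩ => ?_⟩
      rw [hr]
      have : σ i ∈ Set.Iic k := hr ▸ ⟨i, rfl⟩
      exact le_trans hi this
    · rw [hr]
      exact isGreatest_Iic

theorem phi_bijOn {n k : ℕ} (hk : k < n) :
    Set.BijOn (phi n) (inversionCayley n k) (increasingTrees (k + 1) (n - k)) := by
  refine ⟨?_, (phi_injOn n).mono fun σ h => h.1.1, ?_⟩
  · intro σ h
    rw [inversionCayley_eq] at h
    obtain ⟨hσ, hr⟩ := h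
    refine ⟨phiGraph_isTree hσ, phi_isIncreasing hσ, by change n + 1 = _; omega, fun v => ?_⟩
    rw [phi_isInternal hσ, hr, Set.mem_Iic, Nat.lt_succ_iff]
  · rintro t ⟨hT, hI, hs, hint⟩
    obtain ⟨σ, hσ, rfl⟩ := exists_phi_eq (n := n) hT hI (by omega)
    refine ⟨σ, ?_, rfl⟩
    rw [inversionCayley_eq]
    refine ⟨hσ, ?_⟩
    ext j
    constructor
    · rintro ⟨i, rfl⟩
      have := hσ i
      have h := (hint ⟨σ i, by change _ < n + 1; omega⟩).1 ((phi_isInternal hσ _).2 ⟨i, rfl⟩)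
      exact Nat.lt_succ_iff.1 h
    · intro hj
      have hj : j ≤ k := hj
      exact (phi_isInternal hσ ⟨j, by omega⟩).1
        ((hint ⟨j, by change j < n + 1; omega⟩).2 (Nat.lt_succ_iff.2 hj))

theorem ncard_increasingTrees (n : ℕ) {k : ℕ} (hk : 1 ≤ k) :
    (increasingTrees (n + 1) k).ncard = (inversionCayley (n + k) n).ncard := by
  have h := phi_bijOn (n := n + k) (k := n) (by omega)
  rw [Nat.add_sub_cancel_left] at h
  rw [← h.image_eq, h.injOn.ncard_image]

theorem inversionSequences_finite (n : ℕ) : (inversionSequences n).Finite :=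
  (Set.Finite.pi' fun i : Fin n => Set.finite_Iic (i : ℕ)).subset fun _ h => h

theorem ncard_inversion_inter_cayley {n : ℕ} (hn : 1 ≤ n) :
    (inversionSequences n ∩ cayleyPermutations n).ncard =
      ∑ k ∈ Finset.range n, (inversionCayley n k).ncard := by
  classical
  have hfin : (inversionSequences n ∩ cayleyPermutations n).Finite :=
    (inversionSequences_finite n).subset Set.inter_subset_left
  have hgreat : ∀ σ : Fin n → ℕ, IsGreatest (Set.range σ) (Finset.univ.sup σ) := by
    intro σ
    have : Nonempty (Fin n) := ⟨⟨0, hn⟩⟩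
    obtain ⟨i, -, hi⟩ := Finset.exists_mem_eq_sup Finset.univ Finset.univ_nonempty σ
    refine ⟨⟨i, hi.symm⟩, ?_⟩
    rintro _ ⟨j, rfl⟩
    exact Finset.le_sup (Finset.mem_univ j)
  rw [Set.ncard_eq_toFinset_card _ hfin, Finset.card_eq_sum_card_fiberwise
    (f := fun σ => Finset.univ.sup σ) (t := Finset.range n)]
  · refine Finset.sum_congr rfl fun k _ => ?_
    rw [← Set.ncard_coe_finset]
    congr 1
    ext σ
    simp only [Finset.coe_filter, Set.Finite.mem_toFinset, Set.mem_ofPred_eq, inversionCayley]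
    refine and_congr_right fun _ => ⟨fun h => h ▸ hgreat σ, fun h => (hgreat σ).unique h⟩
  · intro σ hσ
    have hσ : σ ∈ inversionSequences n ∩ cayleyPermutations n := by simpa using hσ
    obtain ⟨i, hi⟩ := (hgreat σ).1
    have := hσ.1 i
    simp only [Finset.coe_range, Set.mem_Iio]
    omega

/-! ### Inclusion-exclusion and the recurrence in the number of internal nodes -/

/-- Inclusion-exclusion for the sequences with entries in given sets that take all values in a
given set. -/
theorem card_filter_covers {N : ℕ} (A : Fin N → Finset ℕ) (V : Finset ℕ) :
    (((Fintype.piFinset A).filter fun σ => V ⊆ Finset.univ.image σ).card : ℤ) =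
      ∑ T ∈ V.powerset, (-1) ^ T.card * ∏ i, ((A i \ T).card : ℤ) := by
  classical
  have h1 : ∀ σ : Fin N → ℕ, (if V ⊆ Finset.univ.image σ then (1 : ℤ) else 0) =
      ∑ T ∈ V.powerset, if ∀ i, σ i ∉ T then (-1) ^ T.card else 0 := by
    intro σ
    -- The sets avoided by `σ` are the subsets of the set of missed values, so their alternating sum
    -- is `1` exactly when nothing is missed.
    have h2 : V.powerset.filter (fun T => ∀ i, σ i ∉ T) =
        (V.filter fun v => ∀ i, σ i ≠ v).powerset := by
      ext T
      simp only [Finset.mem_filter, Finset.mem_powerset, Finset.subset_iff]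
      constructor
      · rintro ⟨h, h'⟩ v hv
        exact ⟨h hv, fun i hi => h' i (hi ▸ hv)⟩
      · exact fun h => ⟨fun v hv => (h hv).1, fun i hi => (h hi).2 i rfl⟩
    rw [← Finset.sum_filter, h2, Finset.sum_powerset_neg_one_pow_card]
    refine if_congr ?_ rfl rfl
    simp [Finset.filter_eq_empty_iff, Finset.subset_iff]
  rw [Finset.card_filter, Nat.cast_sum]
  push_cast
  simp_rw [h1]
  rw [Finset.sum_comm]
  refine Finset.sum_congr rfl fun T _ => ?_
  rw [← Finset.sum_filter, Finset.sum_const, nsmul_eq_mul, mul_comm, ← Nat.cast_prod,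
    ← Fintype.card_piFinset]
  congr 3
  ext σ
  simp [Fintype.mem_piFinset, forall_and]

/-- Putting the bound `n` into the ranges of the entries leaves only a covering condition, the form
needed by `card_filter_covers`. -/
theorem inversionCayley_eq_coe (n k : ℕ) : inversionCayley (n + k) n =
    ((Fintype.piFinset fun i : Fin (n + k) => Finset.range (min (i : ℕ) n + 1)).filter
      fun σ => Finset.range (n + 1) ⊆ Finset.univ.image σ : Finset (Fin (n + k) → ℕ)) := by
  rw [inversionCayley_eq]
  ext σ
  simp only [Finset.coe_filter, Set.mem_ofPred_eq, Fintype.mem_piFinset, Finset.mem_range,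
    Finset.subset_iff, Finset.mem_image, Finset.mem_univ, true_and, Nat.lt_succ_iff]
  constructor
  · rintro ⟨hσ, hr⟩
    exact ⟨fun i => le_min (hσ i) (hr.le ⟨i, rfl⟩), fun v hv => hr.ge hv⟩
  · rintro ⟨h1, h2⟩
    refine ⟨fun i => (h1 i).trans (min_le_left _ _), Set.Subset.antisymm ?_ h2⟩
    rintro _ ⟨i, rfl⟩
    exact (h1 i).trans (min_le_right _ _)

theorem ncard_inversionCayley (n k : ℕ) : ((inversionCayley (n + k) n).ncard : ℤ) =
    ∑ T ∈ (Finset.range (n + 1)).powerset, (-1) ^ T.card *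
      (∏ i ∈ Finset.range n, ((Finset.range (i + 1) \ T).card : ℤ)) *
        ((Finset.range (n + 1) \ T).card : ℤ) ^ k := by
  rw [inversionCayley_eq_coe, Set.ncard_coe_finset, card_filter_covers]
  refine Finset.sum_congr rfl fun T _ => ?_
  rw [mul_assoc]
  congr 1
  rw [Fin.prod_univ_eq_prod_range
    (fun i => ((Finset.range (min i n + 1) \ T).card : ℤ)) (n + k), Finset.prod_range_add]
  congr 1
  · refine Finset.prod_congr rfl fun i hi => ?_
    rw [min_eq_left (Finset.mem_range.1 hi).le]
  · simp

/-- The signed exponential sum that inclusion-exclusion gives for the exponential generating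
function, in the number of leaves, of the increasing trees with `n + 1` internal nodes. -/
noncomputable def leafEGF (n : ℕ) : PowerSeries ℚ :=
  ∑ T ∈ (Finset.range (n + 1)).powerset,
    ((-1) ^ T.card * ∏ i ∈ Finset.range n, ((Finset.range (i + 1) \ T).card : ℚ)) •
      PowerSeries.exp ℚ ^ (Finset.range (n + 1) \ T).card

theorem coeff_leafEGF (n k : ℕ) : PowerSeries.coeff k (leafEGF n) =
    ((inversionCayley (n + k) n).ncard : ℚ) / k ! := by
  have h := congrArg (Int.cast : ℤ → ℚ) (ncard_inversionCayley n k)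
  push_cast at h
  rw [h, leafEGF, map_sum, Finset.sum_div]
  refine Finset.sum_congr rfl fun T _ => ?_
  rw [PowerSeries.coeff_smul, PowerSeries.exp_pow_eq_rescale_exp, PowerSeries.coeff_rescale,
    PowerSeries.coeff_exp, Algebra.algebraMap_self, RingHom.id_apply]
  ring

theorem leafEGF_zero : leafEGF 0 = PowerSeries.exp ℚ - 1 := by
  have h : (Finset.range (0 + 1)).powerset = {∅, {0}} := by decide
  rw [leafEGF, h, Finset.sum_pair (by decide)]
  simp [sub_eq_add_neg]

theorem derivative_exp_pow (c : ℕ) : PowerSeries.derivative ℚ (PowerSeries.exp ℚ ^ c) =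
    (c : ℚ) • PowerSeries.exp ℚ ^ c := by
  rw [PowerSeries.derivative_pow, PowerSeries.derivative_exp]
  cases c with
  | zero => simp
  | succ c =>
    rw [Nat.add_sub_cancel, mul_assoc, ← pow_succ, ← nsmul_eq_mul, Nat.cast_smul_eq_nsmul]

/-- Pair `T` with `T ∪ {n + 1}`: the signs are opposite, the products agree, and the exponentials
are `e^{(c+1)t}` and `e^{ct}`, where `c = |{0, …, n} \ T|`. The difference contributes `e^t - 1`,
and the new factor `c` of the product is the one produced by differentiating `e^{ct}`. -/
theorem leafEGF_succ (n : ℕ) : leafEGF (n + 1) =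
    (PowerSeries.exp ℚ - 1) * PowerSeries.derivative ℚ (leafEGF n) := by
  rw [leafEGF, Finset.range_add_one (n := n + 1), Finset.sum_powerset_insert (by simp), leafEGF,
    map_sum, Finset.mul_sum, ← Finset.sum_add_distrib]
  refine Finset.sum_congr rfl fun T hT => ?_
  have hn : n + 1 ∉ T := fun h => by
    have := Finset.mem_range.1 (Finset.mem_powerset.1 hT h)
    omega
  have hi : ∀ i ∈ Finset.range (n + 1), Finset.range (i + 1) \ insert (n + 1) T =
      Finset.range (i + 1) \ T := by
    intro i hi
    rw [Finset.sdiff_insert, Finset.erase_eq_of_notMem]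
    simp only [Finset.mem_sdiff, Finset.mem_range] at hi ⊢
    omega
  have h1 : (insert (n + 1) (Finset.range (n + 1)) \ T).card =
      (Finset.range (n + 1) \ T).card + 1 := by
    rw [Finset.insert_sdiff_of_notMem _ hn, Finset.card_insert_of_notMem (by simp)]
  have h2 : insert (n + 1) (Finset.range (n + 1)) \ insert (n + 1) T =
      Finset.range (n + 1) \ T := by
    rw [Finset.insert_sdiff_of_mem _ (Finset.mem_insert_self _ _), hi n (by simp)]
  have h3 : ∏ i ∈ Finset.range (n + 1), ((Finset.range (i + 1) \ insert (n + 1) T).card : ℚ) =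
      ∏ i ∈ Finset.range (n + 1), ((Finset.range (i + 1) \ T).card : ℚ) :=
    Finset.prod_congr rfl fun i h => by rw [hi i h]
  rw [h1, h2, Finset.card_insert_of_notMem hn, Derivation.map_smul, derivative_exp_pow,
    h3, Finset.prod_range_succ]
  simp only [PowerSeries.smul_eq_C_mul, map_mul, map_pow, map_neg, map_one, pow_succ]
  ring

/-! ### The chain rule for substitution -/

/-- For polynomials this holds for any derivation. In general, split off `X^N g`: the terms in `N
a^{N-1}` cancel, so the two sides differ by a multiple of `a^N`, which is invisible in any fixed
degree once `N` is large. -/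
theorem pderiv_subst {τ R : Type*} [CommRing R] (i : τ) {a : MvPowerSeries τ R}
    (ha : MvPowerSeries.constantCoeff a = 0) (f : PowerSeries R) :
    MvPowerSeries.pderiv R i (f.subst a) =
      (PowerSeries.derivative R f).subst a * MvPowerSeries.pderiv R i a := by
  have hs := PowerSeries.HasSubst.of_constantCoeff_zero ha
  have hpoly : ∀ p : Polynomial R, MvPowerSeries.pderiv R i ((p : PowerSeries R).subst a) =
      (PowerSeries.derivative R (p : PowerSeries R)).subst a * MvPowerSeries.pderiv R i a := by
    intro p
    rw [PowerSeries.derivative_coe, PowerSeries.subst_coe hs, PowerSeries.subst_coe hs,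
      ← smul_eq_mul]
    exact Derivation.comp_aeval_eq (a := a) (MvPowerSeries.pderiv R i) p
  have hX : ∀ m : ℕ, ((PowerSeries.X : PowerSeries R) ^ m).subst a = a ^ m := fun m => by
    rw [PowerSeries.subst_pow hs, PowerSeries.subst_X hs]
  have hdiff : ∀ N : ℕ, ∃ h, MvPowerSeries.pderiv R i (f.subst a) =
      (PowerSeries.derivative R f).subst a * MvPowerSeries.pderiv R i a + a ^ N * h := by
    intro N
    obtain ⟨g, hg⟩ : ∃ g : PowerSeries R, f = PowerSeries.X ^ N * g +
        ((f.trunc N : Polynomial R) : PowerSeries R) :=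
      ⟨_, f.eq_X_pow_mul_shift_add_trunc N⟩
    refine ⟨MvPowerSeries.pderiv R i (g.subst a) -
      (PowerSeries.derivative R g).subst a * MvPowerSeries.pderiv R i a, ?_⟩
    generalize f.trunc N = p at hg
    subst hg
    have hN : (N : PowerSeries R).subst a = (N : MvPowerSeries τ R) := by
      rw [← PowerSeries.coe_substAlgHom hs, map_natCast]
    rw [PowerSeries.subst_add hs, map_add, hpoly, map_add, PowerSeries.subst_add hs,
      PowerSeries.subst_mul hs, hX, Derivation.leibniz, Derivation.leibniz,
      PowerSeries.derivative_pow, MvPowerSeries.pderiv_pow, PowerSeries.derivative_X, mul_one,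
      smul_eq_mul, smul_eq_mul, smul_eq_mul, smul_eq_mul, PowerSeries.subst_add hs,
      PowerSeries.subst_mul hs, PowerSeries.subst_mul hs, PowerSeries.subst_mul hs, hX, hX, hN]
    ring
  classical
  ext d
  obtain ⟨h, hh⟩ := hdiff (d.degree + 1)
  rw [hh, map_add, add_eq_left]
  apply MvPowerSeries.coeff_of_lt_order
  refine lt_of_lt_of_le ?_ (MvPowerSeries.le_order_mul)
  have h1 := MvPowerSeries.le_order_pow_of_constantCoeff_eq_zero (d.degree + 1) ha
  refine lt_of_lt_of_le ?_ (h1.trans le_self_add)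
  exact_mod_cast Nat.lt_succ_self _

/-! ### Polylogarithms and poly-Bernoulli numbers -/

theorem derivative_polylog (s : ℤ) :
    PowerSeries.X * PowerSeries.derivative ℚ (polylog s) = polylog (s - 1) := by
  ext m
  cases m with
  | zero => simp [polylog]
  | succ m =>
    have hm : ((m : ℚ) + 1) ≠ 0 := by positivity
    rw [PowerSeries.coeff_succ_X_mul, PowerSeries.coeff_derivative, polylog, polylog,
      PowerSeries.coeff_mk, PowerSeries.coeff_mk, if_neg m.succ_ne_zero, if_neg m.succ_ne_zero]
    push_cast
    rw [zpow_sub_one₀ hm, mul_inv, inv_inv]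

theorem polylog_zero_mul : polylog 0 * (1 - PowerSeries.X) = PowerSeries.X := by
  ext m
  rcases m with _ | _ | m
  · simp [polylog]
  · simp [polylog, mul_sub, PowerSeries.coeff_succ_mul_X, PowerSeries.coeff_one_X]
  · simp [polylog, mul_sub, PowerSeries.coeff_succ_mul_X, PowerSeries.coeff_X]

theorem hasSubst_oneSubExpNeg : PowerSeries.HasSubst oneSubExpNeg := by
  refine PowerSeries.HasSubst.of_constantCoeff_zero' ?_
  rw [oneSubExpNeg, PowerSeries.evalNegHom, ← PowerSeries.coeff_zero_eq_constantCoeff_apply,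
    map_sub, PowerSeries.coeff_rescale]
  simp

theorem derivative_oneSubExpNeg :
    PowerSeries.derivative ℚ oneSubExpNeg = 1 - oneSubExpNeg := by
  have h : PowerSeries.derivative ℚ (PowerSeries.evalNegHom (PowerSeries.exp ℚ)) =
      - PowerSeries.evalNegHom (PowerSeries.exp ℚ) := by
    ext m
    simp only [PowerSeries.evalNegHom, PowerSeries.coeff_derivative, PowerSeries.coeff_rescale,
      PowerSeries.coeff_exp, map_neg, Nat.factorial_succ]
    have hm : ((m : ℚ) + 1) ≠ 0 := by positivity
    have hm' : (m ! : ℚ) ≠ 0 := by positivity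
    simp only [Algebra.algebraMap_self, RingHom.id_apply]
    push_cast
    field_simp
    ring
  rw [oneSubExpNeg, map_sub, h, PowerSeries.derivative_one]
  ring

theorem exp_mul_oneSubExpNeg :
    PowerSeries.exp ℚ * (1 - oneSubExpNeg) = 1 := by
  rw [oneSubExpNeg, sub_sub_cancel, PowerSeries.exp_mul_exp_neg_eq_one]

/-- The series `F n` determined by `F 0 = exp - 1` and `F (n + 1) = (exp - 1) * (F n)'`
are the polylogarithms of nonpositive order at `1 - e ^ (-t)`. -/
theorem eq_polylog_subst {F : ℕ → PowerSeries ℚ} (h0 : F 0 = PowerSeries.exp ℚ - 1)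
    (hF : ∀ n, F (n + 1) = (PowerSeries.exp ℚ - 1) * PowerSeries.derivative ℚ (F n)) (n : ℕ) :
    F n = (polylog (-(n : ℤ))).subst oneSubExpNeg := by
  have hs := hasSubst_oneSubExpNeg
  have hE := exp_mul_oneSubExpNeg
  induction n with
  | zero =>
    have h := congrArg (PowerSeries.substAlgHom hs) polylog_zero_mul
    rw [map_mul, map_sub, map_one, PowerSeries.substAlgHom_X,
      PowerSeries.coe_substAlgHom] at h
    rw [h0, Nat.cast_zero, neg_zero]
    linear_combination ((polylog 0).subst oneSubExpNeg + 1) * hE - PowerSeries.exp ℚ * h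
  | succ n ih =>
    have h := congrArg (PowerSeries.substAlgHom hs) (derivative_polylog (-(n : ℤ)))
    rw [map_mul, PowerSeries.substAlgHom_X, PowerSeries.coe_substAlgHom] at h
    rw [hF, ih, PowerSeries.derivative_subst hs, derivative_oneSubExpNeg,
      show -((n + 1 : ℕ) : ℤ) = -(n : ℤ) - 1 by push_cast; ring, ← h]
    -- With `z = 1 - e^{-t}`, one has `z' = 1 - z` and `(e^t - 1)(1 - z) = z`, which turns the
    -- recurrence into `z Li_s'(z) = Li_{s-1}(z)`.
    linear_combination (PowerSeries.derivative ℚ (polylog (-(n : ℤ)))).subst oneSubExpNeg * hE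

/-- The numerator is `F (n + 1)`, so the Laurent quotient is the power series `(F n)'`; this
accounts for the index shift. -/
theorem polyBernoulliC_eq {F : ℕ → PowerSeries ℚ} (h0 : F 0 = PowerSeries.exp ℚ - 1)
    (hF : ∀ n, F (n + 1) = (PowerSeries.exp ℚ - 1) * PowerSeries.derivative ℚ (F n)) (n j : ℕ) :
    polyBernoulliC (-((n + 1 : ℕ) : ℤ)) j = ((j + 1)! : ℚ) * PowerSeries.coeff (j + 1) (F n) := by
  have hne : ((PowerSeries.exp ℚ - 1 : PowerSeries ℚ) : LaurentSeries ℚ) ≠ 0 := by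
    intro h
    have h1 := congrArg (fun x => HahnSeries.coeff x ((1 : ℕ) : ℤ)) h
    simp only [LaurentSeries.coeff_coe_powerSeries] at h1
    simp [PowerSeries.coeff_exp, PowerSeries.coeff_one] at h1
  rw [polyBernoulliC, ← eq_polylog_subst h0 hF, hF, PowerSeries.coe_mul, mul_div_cancel_left₀ _ hne,
    LaurentSeries.coeff_coe_powerSeries, PowerSeries.coeff_derivative, Nat.factorial_succ]
  push_cast
  ring

/-! ### The logarithm and its partial differential equation -/

theorem formalExp_add : formalExp (MvPowerSeries.X 0 + MvPowerSeries.X 1) =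
    formalExp (MvPowerSeries.X 0) * formalExp (MvPowerSeries.X 1) := by
  ext d
  simp only [formalExp]
  rw [PowerSeries.coeff_subst_X_zero_add_X_one, PowerSeries.coeff_subst_X_zero_subst_mul_X_one]
  simp only [PowerSeries.coeff_exp, Algebra.algebraMap_self, RingHom.id_apply]
  rw [Nat.cast_add_choose]
  have := Nat.factorial_pos (d 0 + d 1)
  field_simp

theorem pderiv_formalExp (i : Fin 2) {f : MvPowerSeries (Fin 2) ℚ}
    (hf : MvPowerSeries.constantCoeff f = 0) :
    MvPowerSeries.pderiv ℚ i (formalExp f) = formalExp f * MvPowerSeries.pderiv ℚ i f := by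
  rw [formalExp, pderiv_subst i hf, PowerSeries.derivative_exp]

theorem derivative_log_mul : PowerSeries.derivative ℚ (PowerSeries.log ℚ) * (1 + PowerSeries.X)
    = 1 := by
  rw [PowerSeries.deriv_log]
  ext m
  cases m with
  | zero => simp
  | succ m =>
    simp [mul_add, PowerSeries.coeff_succ_mul_X, PowerSeries.coeff_one, pow_succ]

theorem pderiv_formalLog_inv (i : Fin 2) {f : MvPowerSeries (Fin 2) ℚ}
    (hf : MvPowerSeries.constantCoeff f = 1) :
    f * MvPowerSeries.pderiv ℚ i (formalLog f⁻¹) = -MvPowerSeries.pderiv ℚ i f := by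
  have hne : MvPowerSeries.constantCoeff f ≠ 0 := by rw [hf]; exact one_ne_zero
  have hinv : f * f⁻¹ = 1 := MvPowerSeries.mul_inv_cancel f hne
  have hc : MvPowerSeries.constantCoeff (f⁻¹ - 1) = 0 := by
    rw [map_sub, MvPowerSeries.constantCoeff_inv, hf]
    simp
  have hs := PowerSeries.HasSubst.of_constantCoeff_zero hc
  have h := congrArg (PowerSeries.substAlgHom hs) derivative_log_mul
  rw [map_mul, map_add, map_one, PowerSeries.substAlgHom_X, PowerSeries.coe_substAlgHom,
    add_sub_cancel] at h
  rw [formalLog, pderiv_subst i hc, map_sub, MvPowerSeries.pderiv_one,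
    MvPowerSeries.pderiv_inv']
  linear_combination (-f * f⁻¹ * MvPowerSeries.pderiv ℚ i f) * h -
    MvPowerSeries.pderiv ℚ i f * hinv

/-- The first order partial differential equation `f_x = (e ^ y - 1) (1 + f_y)`. -/
def SatisfiesTreePDE (f : MvPowerSeries (Fin 2) ℚ) : Prop :=
  MvPowerSeries.pderiv ℚ 0 f =
    (formalExp (MvPowerSeries.X 1) - 1) * (1 + MvPowerSeries.pderiv ℚ 1 f)

theorem satisfiesTreePDE_log : SatisfiesTreePDE (formalLog expDenominator⁻¹) := by
  have h0 := pderiv_formalLog_inv 0 constantCoeff_expDenominator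
  have h1 := pderiv_formalLog_inv 1 constantCoeff_expDenominator
  have hinv : expDenominator * expDenominator⁻¹ = 1 := MvPowerSeries.mul_inv_cancel _ (by
    rw [constantCoeff_expDenominator]; exact one_ne_zero)
  have hD : expDenominator = formalExp (MvPowerSeries.X 0) + formalExp (MvPowerSeries.X 1)
      - formalExp (MvPowerSeries.X 0) * formalExp (MvPowerSeries.X 1) := by
    rw [expDenominator, formalExp_add]
  have e : ∀ i j : Fin 2, MvPowerSeries.pderiv ℚ i (formalExp (MvPowerSeries.X j)) =
      if j = i then formalExp (MvPowerSeries.X j) else 0 := by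
    intro i j
    rw [pderiv_formalExp i (by simp)]
    split_ifs with h
    · rw [h, MvPowerSeries.pderiv_X_self, mul_one]
    · rw [MvPowerSeries.pderiv_X_of_ne h, mul_zero]
  have d0 : MvPowerSeries.pderiv ℚ 0 expDenominator = formalExp (MvPowerSeries.X 0) -
      formalExp (MvPowerSeries.X 0) * formalExp (MvPowerSeries.X 1) := by
    rw [hD, map_sub, map_add, Derivation.leibniz, e, e]
    simp [mul_comm]
  have d1 : MvPowerSeries.pderiv ℚ 1 expDenominator = formalExp (MvPowerSeries.X 1) -
      formalExp (MvPowerSeries.X 0) * formalExp (MvPowerSeries.X 1) := by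
    rw [hD, map_sub, map_add, Derivation.leibniz, e, e]
    simp
  rw [d0] at h0
  rw [d1] at h1
  rw [SatisfiesTreePDE]
  -- For `D = expDenominator`, multiplying through by `D` leaves `-D_x = (e^y - 1)(D - D_y)`, true
  -- because `D - D_y = e^x`.
  have key : expDenominator * (MvPowerSeries.pderiv ℚ 0 (formalLog expDenominator⁻¹) -
      (formalExp (MvPowerSeries.X 1) - 1) *
        (1 + MvPowerSeries.pderiv ℚ 1 (formalLog expDenominator⁻¹))) = 0 := by
    linear_combination h0 - (formalExp (MvPowerSeries.X 1) - 1) * h1 -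
      (formalExp (MvPowerSeries.X 1) - 1) * hD
  have hne : expDenominator ≠ 0 := left_ne_zero_of_mul_eq_one hinv
  exact sub_eq_zero.1 ((mul_eq_zero.1 key).resolve_left hne)

/-- The series `log (1 + X)` is divisible by `X`, and `1/D - 1 = (e^x - 1)(e^y - 1)/D`, so the
logarithm is divisible by `e^x - 1`. -/
theorem coeff_formalLog_expDenominator {d : Fin 2 →₀ ℕ} (hd : d 0 = 0) :
    MvPowerSeries.coeff d (formalLog expDenominator⁻¹) = 0 := by
  have hne : MvPowerSeries.constantCoeff expDenominator ≠ 0 := by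
    rw [constantCoeff_expDenominator]; exact one_ne_zero
  have hinv : expDenominator * expDenominator⁻¹ = 1 := MvPowerSeries.mul_inv_cancel _ hne
  have hc : MvPowerSeries.constantCoeff (expDenominator⁻¹ - 1) = 0 := by
    rw [map_sub, MvPowerSeries.constantCoeff_inv, constantCoeff_expDenominator]
    simp
  have hs := PowerSeries.HasSubst.of_constantCoeff_zero hc
  obtain ⟨q, hq⟩ := PowerSeries.X_dvd_iff.2 (PowerSeries.constantCoeff_log (A := ℚ))
  have hfac : formalLog expDenominator⁻¹ = (formalExp (MvPowerSeries.X 0) - 1) *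
      ((formalExp (MvPowerSeries.X 1) - 1) * expDenominator⁻¹ *
        q.subst (expDenominator⁻¹ - 1)) := by
    rw [formalLog, hq, PowerSeries.subst_mul hs, PowerSeries.subst_X hs]
    have hD : expDenominator = formalExp (MvPowerSeries.X 0) + formalExp (MvPowerSeries.X 1)
        - formalExp (MvPowerSeries.X 0) * formalExp (MvPowerSeries.X 1) := by
      rw [expDenominator, formalExp_add]
    linear_combination (q.subst (expDenominator⁻¹ - 1) : MvPowerSeries (Fin 2) ℚ) *
      (hinv - expDenominator⁻¹ * hD)
  rw [hfac, MvPowerSeries.coeff_mul]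
  refine Finset.sum_eq_zero fun p hp => ?_
  have hp0 : p.1 0 = 0 := by
    have := DFunLike.congr_fun (Finset.HasAntidiagonal.mem_antidiagonal.1 hp) 0
    rw [Finsupp.add_apply] at this
    omega
  rw [map_sub, formalExp, PowerSeries.coeff_subst_single, hp0, Finsupp.single_zero,
    MvPowerSeries.coeff_one]
  split_ifs <;> simp

/-- The left side of the equation raises the exponent of `x` by one and the right side does not, so
each row of coefficients is determined by the earlier ones. -/
theorem eq_of_satisfiesTreePDE {f g : MvPowerSeries (Fin 2) ℚ} (hf : SatisfiesTreePDE f)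
    (hg : SatisfiesTreePDE g)
    (h0 : ∀ d : Fin 2 →₀ ℕ, d 0 = 0 → MvPowerSeries.coeff d f = MvPowerSeries.coeff d g) :
    f = g := by
  have key : ∀ a : ℕ, ∀ d : Fin 2 →₀ ℕ, d 0 = a →
      MvPowerSeries.coeff d f = MvPowerSeries.coeff d g := by
    intro a
    induction a using Nat.strong_induction_on with
    | _ a ih =>
      intro d hd
      obtain rfl | ha := Nat.eq_zero_or_pos a
      · exact h0 d hd
      obtain ⟨e, rfl⟩ : ∃ e, d = e + Finsupp.single 0 1 :=
        ⟨d - Finsupp.single 0 1, (tsub_add_cancel_of_le (by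
          rw [Finsupp.single_le_iff]; omega)).symm⟩
      have he : e 0 + 1 = a := by simpa using hd
      have hpd : MvPowerSeries.coeff e (MvPowerSeries.pderiv ℚ 0 f) =
          MvPowerSeries.coeff e (MvPowerSeries.pderiv ℚ 0 g) := by
        rw [hf, hg, MvPowerSeries.coeff_mul, MvPowerSeries.coeff_mul]
        refine Finset.sum_congr rfl fun p hp => ?_
        have hp0 := DFunLike.congr_fun (Finset.HasAntidiagonal.mem_antidiagonal.1 hp) 0
        rw [Finsupp.add_apply] at hp0
        rw [map_add, map_add, MvPowerSeries.coeff_pderiv, MvPowerSeries.coeff_pderiv,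
          ih (p.2 0) (by omega) (p.2 + Finsupp.single 1 1) (by simp)]
      rw [MvPowerSeries.coeff_pderiv, MvPowerSeries.coeff_pderiv] at hpd
      exact mul_right_cancel₀ (by positivity) hpd
  ext d
  exact key _ d rfl

/-! ### Rows of the tree generating function -/

/-- Multiplying by a series in the second variable acts on each row of coefficients. -/
theorem coeff_subst_X_one_mul {R : Type*} [CommRing R] (f : PowerSeries R)
    {g : ℕ → PowerSeries R} {h : MvPowerSeries (Fin 2) R}
    (hg : ∀ d, MvPowerSeries.coeff d h = PowerSeries.coeff (d 1) (g (d 0))) (d : Fin 2 →₀ ℕ) :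
    MvPowerSeries.coeff d (f.subst (MvPowerSeries.X 1 : MvPowerSeries (Fin 2) R) * h) =
      PowerSeries.coeff (d 1) (f * g (d 0)) := by
  rw [MvPowerSeries.coeff_mul, PowerSeries.coeff_mul]
  symm
  -- Only terms whose first factor is a pure power of `y` survive.
  refine Finset.sum_of_injOn
    (fun p => (Finsupp.single 1 p.1, Finsupp.single 0 (d 0) + Finsupp.single 1 p.2)) ?_ ?_ ?_ ?_
  · rintro ⟨a, b⟩ - ⟨a', b'⟩ - hab
    have h1 := DFunLike.congr_fun (congrArg Prod.fst hab) 1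
    have h2 := DFunLike.congr_fun (congrArg Prod.snd hab) 1
    simp at h1 h2
    rw [h1, h2]
  · rintro ⟨a, b⟩ hab
    have hab : a + b = d 1 := by simpa using hab
    simp only [SetLike.mem_coe, Finset.HasAntidiagonal.mem_antidiagonal]
    ext i
    fin_cases i <;> simp [hab]
  · rintro ⟨u, v⟩ huv hne
    rw [Finset.HasAntidiagonal.mem_antidiagonal] at huv
    dsimp only at huv
    rw [PowerSeries.coeff_subst_single, if_neg, zero_mul]
    intro (hu : u = Finsupp.single 1 (u 1))
    refine hne ⟨(u 1, v 1), ?_, ?_⟩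
    · simp [← huv]
    · refine Prod.ext hu.symm ?_
      have hu0 : u 0 = 0 := by rw [hu]; simp
      ext i
      fin_cases i <;> simp [← huv, hu0]
  · rintro ⟨a, b⟩ -
    rw [PowerSeries.coeff_subst_single, hg]
    simp

theorem coeff_treeEGF_zero {d : Fin 2 →₀ ℕ} (hd : d 0 = 0) :
    MvPowerSeries.coeff d treeEGF = 0 := by
  change treeEGF d = 0
  rw [treeEGF, if_neg (by omega)]

/-- This matches the value `0` that `treeEGF` has by convention when there are no leaves. -/
theorem coeff_zero_leafEGF (n : ℕ) : PowerSeries.coeff 0 (leafEGF n) = 0 := by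
  cases n with
  | zero => simp [leafEGF_zero]
  | succ n => simp [leafEGF_succ]

theorem coeff_leafEGF_of_pos (n : ℕ) {k : ℕ} (hk : 1 ≤ k) :
    PowerSeries.coeff k (leafEGF n) = ((increasingTrees (n + 1) k).ncard : ℚ) / k ! := by
  rw [coeff_leafEGF, ncard_increasingTrees n hk]

theorem coeff_treeEGF {d : Fin 2 →₀ ℕ} {n : ℕ} (hd : d 0 = n + 1) :
    MvPowerSeries.coeff d treeEGF = PowerSeries.coeff (d 1) (leafEGF n) / (n + 1)! := by
  change treeEGF d = _
  rw [treeEGF]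
  obtain h | h := Nat.eq_zero_or_pos (d 1)
  · rw [h, coeff_zero_leafEGF, if_neg (by omega), zero_div]
  · rw [if_pos ⟨by omega, h⟩, coeff_leafEGF_of_pos n h, hd, div_div, mul_comm]

theorem satisfiesTreePDE_treeEGF : SatisfiesTreePDE treeEGF := by
  -- The rows of `1 + T_y`: row `0` is only the constant `1`, and multiplied by `e^y - 1` it yields
  -- the initial value `L_0`.
  let g : ℕ → PowerSeries ℚ := fun a =>
    if a = 0 then 1 else ((a ! : ℚ)⁻¹) • PowerSeries.derivative ℚ (leafEGF (a - 1))
  have hg : ∀ d, MvPowerSeries.coeff d (1 + MvPowerSeries.pderiv ℚ 1 treeEGF) =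
      PowerSeries.coeff (d 1) (g (d 0)) := by
    intro d
    rw [map_add, MvPowerSeries.coeff_pderiv, MvPowerSeries.coeff_one]
    obtain h | ⟨n, h⟩ : d 0 = 0 ∨ ∃ n, d 0 = n + 1 := by
      cases d 0 <;> simp
    · rw [coeff_treeEGF_zero (by simpa using h), zero_mul, add_zero]
      simp only [g, h, if_true, PowerSeries.coeff_one]
      refine if_congr ⟨fun hd => by simp [hd], fun h1 => ?_⟩ rfl rfl
      ext i
      fin_cases i
      · exact h
      · exact h1
    · have hd : d ≠ 0 := by
        rintro rfl
        simp at h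
      rw [if_neg hd, zero_add, coeff_treeEGF (n := n) (by simpa using h)]
      simp only [g, h, if_neg n.succ_ne_zero, Nat.add_sub_cancel, PowerSeries.coeff_smul,
        PowerSeries.coeff_derivative]
      simp
      ring
  have hE : formalExp (MvPowerSeries.X 1) - 1 =
      (PowerSeries.exp ℚ - 1).subst (MvPowerSeries.X 1 : MvPowerSeries (Fin 2) ℚ) := by
    rw [← PowerSeries.coe_substAlgHom (PowerSeries.HasSubst.X 1), map_sub, map_one,
      PowerSeries.coe_substAlgHom, formalExp]
  rw [SatisfiesTreePDE, hE]
  ext d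
  rw [coeff_subst_X_one_mul _ hg, MvPowerSeries.coeff_pderiv,
    coeff_treeEGF (n := d 0) (by simp)]
  have hfac : ((d 0 + 1)! : ℚ) = (d 0 + 1) * (d 0)! := by
    rw [Nat.factorial_succ]; push_cast; ring
  have hpos : ((d 0)! : ℚ) ≠ 0 := by positivity
  have hpos' : ((d 0 : ℚ) + 1) ≠ 0 := by positivity
  have h1 : (d + Finsupp.single 0 1 : Fin 2 →₀ ℕ) 1 = d 1 := by simp
  rw [h1, hfac]
  simp only [g]
  split_ifs with h
  · rw [h, leafEGF_zero]; simp
  · obtain ⟨n, hn⟩ := Nat.exists_eq_succ_of_ne_zero h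
    rw [mul_smul_comm, PowerSeries.coeff_smul, hn, Nat.succ_sub_one, ← leafEGF_succ, smul_eq_mul]
    rw [hn] at hpos hpos'
    field_simp

theorem treeEGF_eq : treeEGF = formalLog (expDenominator⁻¹) :=
  eq_of_satisfiesTreePDE satisfiesTreePDE_treeEGF satisfiesTreePDE_log fun _ hd => by
    rw [coeff_treeEGF_zero hd, coeff_formalLog_expDenominator hd]

theorem ncard_increasingTrees_eq_polyBernoulliC {n k : ℕ} (hn : 1 ≤ n) (hk : 1 ≤ k) :
    ((increasingTrees n k).ncard : ℚ) = polyBernoulliC (-(n : ℤ)) (k - 1) := by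
  obtain ⟨n, rfl⟩ := Nat.exists_eq_succ_of_ne_zero (Nat.one_le_iff_ne_zero.1 hn)
  obtain ⟨k, rfl⟩ := Nat.exists_eq_succ_of_ne_zero (Nat.one_le_iff_ne_zero.1 hk)
  rw [Nat.succ_sub_one, Nat.succ_eq_add_one, Nat.succ_eq_add_one,
    polyBernoulliC_eq leafEGF_zero leafEGF_succ, coeff_leafEGF_of_pos n (by omega)]
  field_simp

theorem ncard_inter_eq_sum_increasingTrees {n : ℕ} (hn : 1 ≤ n) :
    (inversionSequences n ∩ cayleyPermutations n).ncard =
      ∑ k ∈ Finset.range n, (increasingTrees (k + 1) (n - k)).ncard := by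
  rw [ncard_inversion_inter_cayley hn]
  refine Finset.sum_congr rfl fun k hk => ?_
  have hk := Finset.mem_range.1 hk
  rw [ncard_increasingTrees k (by omega), Nat.add_sub_cancel' hk.le]

end IncreasingTrees

theorem theorem6p1 :
    -- the generating function of increasing trees
    IncreasingTrees.treeEGF
        = IncreasingTrees.formalLog (IncreasingTrees.expDenominator⁻¹) ∧
    -- `φ(σ)` is an increasing tree, and the children of `v` in it are the positions of `v` in `σ`
    (∀ (n : ℕ), ∀ σ ∈ IncreasingTrees.inversionSequences n,
      (IncreasingTrees.phi n σ).graph.IsTree ∧ (IncreasingTrees.phi n σ).IsIncreasing ∧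
      ∀ v w : Fin (n + 1), (IncreasingTrees.phi n σ).IsParent v w ↔
        ∃ i : Fin n, w = i.succ ∧ σ i = (v : ℕ)) ∧
    -- the inversion sequences of length `n` that correspond to trees are those with values `[0, k]`
    (∀ n k : ℕ, 1 ≤ n → IncreasingTrees.inversionCayley n k
        = {σ | σ ∈ IncreasingTrees.inversionSequences n ∧ Set.range σ = Set.Iic k}) ∧
    (∀ n k : ℕ, k < n → Set.BijOn (IncreasingTrees.phi n)
        (IncreasingTrees.inversionCayley n k) (IncreasingTrees.increasingTrees (k + 1) (n - k))) ∧
    -- trees are counted by the poly-Bernoulli numbers of type C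
    (∀ n k : ℕ, 1 ≤ n → 1 ≤ k → ((IncreasingTrees.increasingTrees n k).ncard : ℚ)
        = IncreasingTrees.polyBernoulliC (-(n : ℤ)) (k - 1)) ∧
    -- antidiagonal sums
    (∀ n : ℕ, 1 ≤ n →
      (IncreasingTrees.inversionSequences n ∩ IncreasingTrees.cayleyPermutations n).ncard
          = ∑ k ∈ Finset.range n, (IncreasingTrees.increasingTrees (k + 1) (n - k)).ncard ∧
      ((IncreasingTrees.inversionSequences n ∩ IncreasingTrees.cayleyPermutations n).ncard : ℚ)
          = ∑ k ∈ Finset.range n,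
              IncreasingTrees.polyBernoulliC (-((k + 1 : ℕ) : ℤ)) (n - k - 1)) := by
  refine ⟨IncreasingTrees.treeEGF_eq, fun n σ hσ => ⟨IncreasingTrees.phiGraph_isTree hσ,
    IncreasingTrees.phi_isIncreasing hσ, IncreasingTrees.phi_isParent hσ⟩,
    fun n k _ => IncreasingTrees.inversionCayley_eq k, fun n k => IncreasingTrees.phi_bijOn,
    fun n k => IncreasingTrees.ncard_increasingTrees_eq_polyBernoulliC, fun n hn =>
      ⟨IncreasingTrees.ncard_inter_eq_sum_increasingTrees hn, ?_⟩⟩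
  rw [IncreasingTrees.ncard_inter_eq_sum_increasingTrees hn, Nat.cast_sum]
  refine Finset.sum_congr rfl fun k hk => ?_
  have hk := Finset.mem_range.1 hk
  exact IncreasingTrees.ncard_increasingTrees_eq_polyBernoulliC (by omega) (by omega)
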